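/- **Setting.** Let $\mathbb F$ be the free group on $m$ generators ($m$ finite), with unit $e$; let $|s|$ be the length of the reduced form of $s$, $S_n=\{s:|s|\le n\}$, and let $\mathcal H$ be a complex Hilbert space. A function $\Psi:\mathbb F\to\mathcal L(\mathcal H)$ is *positive definite* if for all $s_1,\dots,s_k\in\mathbb F$ the block operator matrix $[\Psi(s_i^{-1}s_j)]_{i,j=1}^k$ is positive semidefinite on $\mathcal H^k$. A function $\Phi:\mathbb F\to\mathcal L(\mathcal H)$ is *quasi-multiplicative* if $\Phi(e)=I$, $\|\Phi(s)\|\le 1$ and $\Phi(s^{-1})=\Phi(s)^*$ for all $s$, and $\Phi(st)=\Phi(s)\Phi(t)$ whenever $|st|=|s|+|t|$. A total order $\preceq$ on $\mathbb F$ is *lexicographic* if $s\preceq t$ holds whenever $|s|<|t|$, and also whenever $|s|=|t|$, $s\ne t$, and the first letter in which the reduced form of $s$ differs from that of $t$ is $\preceq$ the corresponding letter of $t$ (letters are generators and their inverses). Fix such an order. The classes $\hat s=\{s,s^{-1}\}$ are ordered by their minimal elements. For $\nu\in\mathbb F$ let $\Gamma_\nu$ be the graph with vertex set $\mathbb F$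 in which $s\neq t$ are adjacent iff $\widehat{s^{-1}t}\preceq\hat\nu$. For a finite positive semidefinite block matrix $A=(A_{ij})_{i,j\in I}$ with entries in $\mathcal L(\mathcal H)$, let $\omega_i=A^{1/2}\iota_i:\mathcal H\to\bigoplus_{i\in I}\mathcal H$, where $\iota_i$ is the $i$-th canonical embedding; so $A_{ij}=\omega_i^*\omega_j$. For $J\subset I$ let $\mathcal R(A|J)$ be the closed linear span of $\omega_i\mathcal H$, $i\in J$. For $k\ne l$ in $I$ let $$\gamma_{k,l}(A):\ \mathcal R(A|I\setminus\{k\})\ominus\mathcal R(A|I\setminus\{k,l\})\to \mathcal R(A|I\setminus\{l\})\ominus\mathcal R(A|I\setminus\{k,l\})$$ be the restriction to the first space of the orthogonal projection onto the second. Let $\varphi:S_n\to\mathcal L(\mathcal H)$. A function $\Psi:\mathbb F\to\mathcal L(\mathcal H)$ is a *central extension of $\varphi$ with respect to $\preceq$* if $\Psi$ is positive definite, $\Psi|_{S_n}=\varphi$, and $\gamma_{\nu,e}\big([\Psi(s^{-1}t)]_{s,t\in C_\nu}\big)=0$ for every $\nu\in\mathbb F$ with $|\nu|>n$ and $\nu\preceq\nu^{-1}$,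 where $C_\nu$ is the (finite) maximal clique of $\Gamma_\nu$ containing $e$ and $\nu$. **Theorem 6.2.** Let $\Phi:\mathbb F\to\mathcal L(\mathcal H)$ be quasi-multiplicative. Then $\Phi$ is the central extension of its restriction to $S_1$: for every lexicographic order $\preceq$ on $\mathbb F$, $\Phi$ is a central extension of $\Phi|_{S_1}$ with respect to $\preceq$ (in particular $\Phi$ is positive definite), and it is the only one. -/

import Mathlib

noncomputable section

namespace FreeExt

/-! ### The free group, lexicographic orders and the graphs `Γ_ν` -/

/-- `S_n`: the elements of reduced length at most `n`. -/
def ball (m n : ℕ) : Set (FreeGroup (Fin m)) := {s | s.norm ≤ n}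

/-- A total order on the free group is lexicographic if it refines the length, and words of equal
length are compared by the first letters in which their reduced forms differ (`u` is the common
beginning of the two words, and `a`, `b` are the letters which follow it); the letters, i.e. the
generators and their inverses, are compared as elements of the free group. -/
structure IsLexicographic {m : ℕ} (L : LinearOrder (FreeGroup (Fin m))) : Prop where
  le_of_norm_lt : ∀ s t : FreeGroup (Fin m), s.norm < t.norm → L.le s t
  le_of_first_letter : ∀ (s t : FreeGroup (Fin m)) (u w z : List (Fin m × Bool))
    (a b : Fin m × Bool), s.norm = t.norm → s.toWord = u ++ a :: w → t.toWord = u ++ b :: z →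
    a ≠ b → L.le (FreeGroup.mk [a]) (FreeGroup.mk [b]) → L.le s t

/-- `Σ_ν`: the union of the classes `{s, s⁻¹}` which do not exceed the class of `ν`, where classes
are compared through their minimal elements. -/
def sigma {m : ℕ} [LinearOrder (FreeGroup (Fin m))] (ν : FreeGroup (Fin m)) :
    Set (FreeGroup (Fin m)) := {s | min s s⁻¹ ≤ min ν ν⁻¹}

/-- `Γ_ν`: distinct `s`, `t` are adjacent iff `s⁻¹ t ∈ Σ_ν`. -/
def gamma {m : ℕ} [LinearOrder (FreeGroup (Fin m))] (ν : FreeGroup (Fin m)) :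
    SimpleGraph (FreeGroup (Fin m)) where
  Adj s t := s ≠ t ∧ s⁻¹ * t ∈ sigma ν
  symm := ⟨by
    rintro s t ⟨h, h'⟩
    refine ⟨h.symm, ?_⟩
    have e : t⁻¹ * s = (s⁻¹ * t)⁻¹ := by group
    change min (t⁻¹ * s) (t⁻¹ * s)⁻¹ ≤ min ν ν⁻¹
    rw [e, inv_inv, min_comm]
    exact h'⟩
  loopless := ⟨fun _ h => h.1 rfl⟩

/-! ### Block operator matrices, realizations and the parameter of a completion -/

section Matrices

variable {ι H : Type*} [Fintype ι] [NormedAddCommGroup H] [InnerProductSpace ℂ H]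

/-- The operator on the Hilbert space direct sum `⨁_{i ∈ ι} H` with block matrix `A`. -/
def blockOp (A : ι → ι → H →L[ℂ] H) :
    PiLp 2 (fun _ : ι => H) →L[ℂ] PiLp 2 (fun _ : ι => H) :=
  (PiLp.continuousLinearEquiv 2 ℂ (fun _ : ι => H)).symm.toContinuousLinearMap ∘L
    ContinuousLinearMap.pi fun i => ∑ j, A i j ∘L PiLp.proj 2 (fun _ : ι => H) j

open scoped Classical in
/-- The canonical embedding of `H` as the `i`-th summand of `⨁_{i ∈ ι} H`. -/
def coordEmb (H : Type*) [NormedAddCommGroup H] [InnerProductSpace ℂ H] (i : ι) :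
    H →L[ℂ] PiLp 2 (fun _ : ι => H) :=
  (PiLp.continuousLinearEquiv 2 ℂ (fun _ : ι => H)).symm.toContinuousLinearMap ∘L
    ContinuousLinearMap.single ℂ (fun _ : ι => H) i

variable [CompleteSpace H]

/-- The maps `ω_i = A^{1/2} ι_i` of the realization of a positive block matrix `A`;
they satisfy `A i j = ω_i* ω_j`. -/
def omega (A : ι → ι → H →L[ℂ] H) (i : ι) : H →L[ℂ] PiLp 2 (fun _ : ι => H) :=
  CFC.sqrt (blockOp A) ∘L coordEmb H i

/-- The realization space of the principal submatrix `A|J`, embedded in the realization space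
of `A`: the closed linear span of the ranges of `ω_i`, `i ∈ J`. -/
def realization (A : ι → ι → H →L[ℂ] H) (J : Set ι) : Submodule ℂ (PiLp 2 (fun _ : ι => H)) :=
  (⨆ i ∈ J, LinearMap.range (omega A i).toLinearMap).topologicalClosure

/-- `R(A|J) ⊖ R(A|J')`. -/
def realizationDiff (A : ι → ι → H →L[ℂ] H) (J J' : Set ι) :
    Submodule ℂ (PiLp 2 (fun _ : ι => H)) :=
  realization A J ⊓ (realization A J')ᗮ

instance completeSpace_realizationDiff (A : ι → ι → H →L[ℂ] H) (J J' : Set ι) :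
    CompleteSpace (realizationDiff A J J') :=
  ((Submodule.isClosed_topologicalClosure _).inter
    (Submodule.isClosed_orthogonal _)).completeSpace_coe

/-- The contraction
`γ : R(A|I∖{k}) ⊖ R(A|I∖{k,l}) → R(A|I∖{l}) ⊖ R(A|I∖{k,l})`
which a positive block matrix `A`, regarded as a completion with respect to the entry `{k, l}`,
determines: the compression of the orthogonal projection. -/
def completionParam (A : ι → ι → H →L[ℂ] H) (k l : ι) :
    realizationDiff A {k}ᶜ {k, l}ᶜ →L[ℂ] realizationDiff A {l}ᶜ {k, l}ᶜ :=
  (realizationDiff A {l}ᶜ {k, l}ᶜ).orthogonalProjectionOnto ∘L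
    (realizationDiff A {k}ᶜ {k, l}ᶜ).subtypeL

end Matrices

/-! ### Positive definite and quasi-multiplicative functions, central extensions -/

section Functions

variable {m : ℕ} {H : Type*} [NormedAddCommGroup H] [InnerProductSpace ℂ H]

/-- Positive definite functions on the free group. -/
def IsPosDef (Ψ : FreeGroup (Fin m) → H →L[ℂ] H) : Prop :=
  ∀ (k : ℕ) (s : Fin k → FreeGroup (Fin m)),
    (blockOp fun i j => Ψ ((s i)⁻¹ * s j)).IsPositive

variable [CompleteSpace H]

/-- Quasi-multiplicative functions on the free group. -/
structure IsQuasiMultiplicative (Φ : FreeGroup (Fin m) → H →L[ℂ] H) : Prop where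
  map_one : Φ 1 = ContinuousLinearMap.id ℂ H
  norm_le_one : ∀ s, ‖Φ s‖ ≤ 1
  map_inv : ∀ s, Φ s⁻¹ = ContinuousLinearMap.adjoint (Φ s)
  map_mul : ∀ s t, (s * t).norm = s.norm + t.norm → Φ (s * t) = Φ s ∘L Φ t

/-- `Ψ` is the central extension of `φ : S_n → L(H)` with respect to the lexicographic order `L`:
it is a positive definite extension of `φ`, and for every class `{ν, ν⁻¹}`, `ν ≤ ν⁻¹`, outside
`S_n` the parameter `γ_ν` of `Ψ` vanishes. Here `γ_ν` is the contraction attached to the completion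
with respect to the entry `{1, ν}` of the block matrix `[Ψ(s⁻¹ t)]_{s, t ∈ C}`, where `C` is the
maximal clique of `Γ_ν` that contains `1` and `ν` (cliques of `Γ_ν` are finite). -/
structure IsCentralExtension (L : LinearOrder (FreeGroup (Fin m))) {n : ℕ}
    (φ : ball m n → H →L[ℂ] H) (Ψ : FreeGroup (Fin m) → H →L[ℂ] H) : Prop where
  posDef : IsPosDef Ψ
  extends_φ : ∀ s : ball m n, Ψ s = φ s
  param_eq_zero : ∀ ν : FreeGroup (Fin m), n < ν.norm → L.le ν ν⁻¹ →
    ∀ C : Finset (FreeGroup (Fin m)), Maximal (gamma ν).IsClique (C : Set (FreeGroup (Fin m))) →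
      ∀ (h1 : 1 ∈ C) (hν : ν ∈ C),
        completionParam (fun s t : C => Ψ ((s : FreeGroup (Fin m))⁻¹ * t)) ⟨ν, hν⟩ ⟨1, h1⟩ = 0

end Functions

end FreeExt

end

namespace FreeExt

/-! ### Reduced words and cliques -/

section Words

open FreeGroup

variable {α : Type*} [DecidableEq α]

/-! Positivity of `Φ` comes from shortening words. Let `c = pa` (reduced, `a` a letter) be a longest
word carrying a vector `x`. For every other word `s` in the support, `s⁻¹c = (s⁻¹p)a` without
cancellation, so replacing `x` at `c` by `Φ(a)x` at `p` keeps all cross terms and only lowers the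
diagonal term, from `‖x‖²` to `‖Φ(a)x‖²`. Iterating leaves a single vector at `1`
(`kernelForm_move_le`, `re_kernelForm_nonneg`).

For the parameters, let `|ν| > 1` and let `a` be the first letter of `ν`. Every `c ≠ 1` in the
maximal clique begins with `a`, since otherwise `|c⁻¹ν| > |ν|`; hence `a` lies in the clique and
`Φ(c⁻¹) = Φ(c⁻¹a)Φ(a⁻¹)`. If `Ψ` agrees with `Φ` below `ν`, then `ω_1 - ω_a Ψ(a⁻¹)` is orthogonal to
every `ω_c` with `c ≠ 1, ν`, and `γ_ν = 0` says exactly that it is orthogonal to `ω_ν` too, i.e.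
that `Ψ(ν⁻¹) = Φ(ν⁻¹)`. This equivalence gives centrality with `Ψ = Φ`, and uniqueness by induction
along the order of classes. -/

theorem norm_inv_mul_of_toWord {s t : FreeGroup α} {u w z : List (α × Bool)}
    (hs : s.toWord = u ++ w) (ht : t.toWord = u ++ z)
    (h : ∀ x ∈ w.head?, ∀ y ∈ z.head?, x ≠ y) :
    (s⁻¹ * t).norm = w.length + z.length := by
  have hw : IsReduced w := (isReduced_toWord (x := s)).infix ⟨u, [], by simp [hs]⟩
  have hz : IsReduced z := (isReduced_toWord (x := t)).infix ⟨u, [], by simp [ht]⟩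
  have hw' : IsReduced (invRev w) := by
    rw [isReduced_iff_reduce_eq, reduce_invRev, hw.reduce_eq]
  have hwz : IsReduced (invRev w ++ z) := by
    -- At the junction the last letter of `invRev w` is the inverse of the first letter of `w`, so
    -- it cancels the first letter of `z` only if these two letters coincide.
    refine List.isChain_append.2 ⟨hw', hz, ?_⟩
    intro x hx y hy hxy
    rw [invRev, List.getLast?_reverse, List.head?_map, Option.mem_map] at hx
    obtain ⟨x', hx', rfl⟩ := hx
    have := h x' hx' y hy
    rcases x' with ⟨i, b⟩
    rcases y with ⟨j, b'⟩
    simp only at hxy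
    subst hxy
    cases b <;> cases b' <;> simp_all
  have e : s⁻¹ * t = mk (invRev w ++ z) := by
    rw [← mk_toWord (x := s), ← mk_toWord (x := t), hs, ht, ← mul_mk, ← mul_mk, ← mul_mk,
      ← inv_mk]
    group
  rw [e, FreeGroup.norm, toWord_mk, hwz.reduce_eq, List.length_append, invRev_length]

/-- Write `x = g y g⁻¹` with `y ≠ 1` cyclically reduced; then `g y y g⁻¹` is reduced and exceeds `x`
by `|y|` letters. -/
theorem norm_lt_norm_mul_self {x : FreeGroup α} (hx : x ≠ 1) : x.norm < (x * x).norm := by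
  have h := reduceCyclically.reduce_flatten_replicate_succ (isReduced_toWord (x := x)) 1
  rw [one_add_one_eq_two, ← toWord_pow, pow_two] at h
  have h1 := reduceCyclically.conj_conjugator_reduceCyclically x.toWord
  have h2 : reduceCyclically x.toWord ≠ [] := by
    intro h0
    apply hx
    rw [h0, List.append_nil] at h1
    rw [← mk_toWord (x := x), ← h1, ← mul_mk, ← inv_mk, mul_inv_cancel]
  have h3 := List.length_pos_iff.2 h2
  have h4 := congrArg List.length h
  have h5 := congrArg List.length h1
  simp only [List.length_append, invRev_length, List.length_flatten, List.map_replicate,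
    List.sum_replicate, smul_eq_mul] at h4 h5
  rw [FreeGroup.norm, FreeGroup.norm]
  omega

theorem norm_mk_singleton (a : α × Bool) : (mk [a]).norm = 1 := by
  simp [FreeGroup.norm, toWord_mk]

theorem norm_mk_singleton_inv_mul {a : α × Bool} {v : List (α × Bool)} {c : FreeGroup α}
    (hc : c.toWord = a :: v) : ((mk [a])⁻¹ * c).norm + 1 = c.norm := by
  rw [norm_inv_mul_of_toWord (u := [a]) (w := []) (z := v) (by simp [toWord_mk]) (by simpa)
    (by simp), FreeGroup.norm, hc]
  simp

/-- The longest word of a set, stripped of its last letter, separates it from the others. -/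
theorem norm_inv_mul_eq_add_one {c p s : FreeGroup α} {a : α × Bool}
    (hc : c.toWord = p.toWord ++ [a]) (hs : s.norm ≤ c.norm) (hsc : s ≠ c) :
    (s⁻¹ * c).norm = (s⁻¹ * p).norm + 1 := by
  -- Since `y` is no longer than `x` and differs from it, `x` is not a prefix of `y`: a nonempty
  -- tail `z ++ [b]` of `x` survives the common prefix, so its last letter never cancels.
  have key : ∀ x y : List (α × Bool), y.length ≤ x.length → y ≠ x → x ≠ [] →
      ∃ u w z, ∃ b, y = u ++ w ∧ x = u ++ (z ++ [b]) ∧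
        ∀ i ∈ w.head?, ∀ j ∈ (z ++ [b]).head?, i ≠ j := by
    intro x
    induction x with
    | nil => intro y _ _ h; exact absurd rfl h
    | cons i x ih =>
      intro y hl hne _
      obtain ⟨z, b, hzb⟩ := (List.eq_nil_or_concat (i :: x)).resolve_left (by simp)
      rw [List.concat_eq_append] at hzb
      rcases y with _ | ⟨j, y⟩
      · exact ⟨[], [], z, b, by simp, by simpa using hzb, by simp⟩
      · by_cases hij : j = i
        · subst hij
          have hxy : y ≠ x := fun h => hne (by rw [h])
          have hl' : y.length ≤ x.length := by simpa using hl
          have hx : x ≠ [] := by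
            rintro rfl
            exact hxy (by simpa using hl')
          obtain ⟨u, w, z, b, h1, h2, h3⟩ := ih y hl' hxy hx
          exact ⟨j :: u, w, z, b, by simp [h1], by simp [h2], h3⟩
        · refine ⟨[], j :: y, z, b, by simp, by simpa using hzb, ?_⟩
          rw [← hzb]
          simpa using hij
  obtain ⟨u, w, z, b, h1, h2, h3⟩ := key c.toWord s.toWord hs
    (fun h => hsc (toWord_injective h)) (by simp [hc])
  have hp : p.toWord = u ++ z := by
    rw [hc, ← List.append_assoc] at h2
    exact (List.append_inj' h2 rfl).1
  rw [norm_inv_mul_of_toWord h1 h2 h3, norm_inv_mul_of_toWord h1 hp, List.length_append,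
    List.length_singleton, add_assoc]
  intro i hi j hj
  refine h3 i hi j ?_
  rcases z with _ | ⟨k, z⟩
  · simp at hj
  · simpa using hj

theorem exists_toWord_eq_append {c : FreeGroup α} (hc : c ≠ 1) :
    ∃ (p : FreeGroup α) (a : α × Bool), c.toWord = p.toWord ++ [a] := by
  obtain ⟨w, a, h⟩ := (List.eq_nil_or_concat c.toWord).resolve_left (by simpa using hc)
  rw [List.concat_eq_append] at h
  refine ⟨mk w, a, ?_⟩
  rw [toWord_mk, IsReduced.reduce_eq, h]
  exact (isReduced_toWord (x := c)).infix ⟨[], [a], by simp [h]⟩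

end Words

/-! ### Maximal cliques of `Γ_ν` through `1` and `ν`. -/

section Cliques

open FreeGroup

variable {m : ℕ}

theorem finite_ball (n : ℕ) : (ball m n).Finite := by
  refine Set.Finite.of_finite_image (f := toWord) ?_ toWord_injective.injOn
  refine (List.finite_length_le (Fin m × Bool) n).subset ?_
  rintro _ ⟨s, hs, rfl⟩
  exact hs

variable [L : LinearOrder (FreeGroup (Fin m))]

theorem norm_min_inv (s : FreeGroup (Fin m)) : (min s s⁻¹).norm = s.norm := by
  rcases min_choice s s⁻¹ with h | h <;> simp [h]

theorem IsLexicographic.norm_le (hL : IsLexicographic L) {s t : FreeGroup (Fin m)} (h : s ≤ t) :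
    s.norm ≤ t.norm := by
  by_contra! h'
  have := le_antisymm h (hL.le_of_norm_lt t s h')
  subst this
  exact lt_irrefl _ h'

theorem IsLexicographic.norm_le_of_mem_sigma (hL : IsLexicographic L) {s ν : FreeGroup (Fin m)}
    (h : s ∈ sigma ν) : s.norm ≤ ν.norm := by
  have := hL.norm_le (show min s s⁻¹ ≤ min ν ν⁻¹ from h)
  rwa [norm_min_inv, norm_min_inv] at this

theorem IsLexicographic.mem_sigma_of_norm_lt (hL : IsLexicographic L) {s ν : FreeGroup (Fin m)}
    (h : s.norm < ν.norm) : s ∈ sigma ν :=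
  hL.le_of_norm_lt _ _ (by rwa [norm_min_inv, norm_min_inv])

theorem IsLexicographic.finite_Iio (hL : IsLexicographic L) (s : FreeGroup (Fin m)) :
    (Set.Iio s).Finite :=
  (finite_ball s.norm).subset fun _ ht => hL.norm_le (le_of_lt ht)

theorem gamma_adj_one {ν : FreeGroup (Fin m)} (hν : ν ≠ 1) : (gamma ν).Adj 1 ν :=
  ⟨hν.symm, by simp [sigma]⟩

variable {ν : FreeGroup (Fin m)} {C : Set (FreeGroup (Fin m))}

theorem IsLexicographic.norm_inv_mul_le_of_isClique (hL : IsLexicographic L)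
    (hC : (gamma ν).IsClique C) {s t : FreeGroup (Fin m)} (hs : s ∈ C) (ht : t ∈ C) :
    (s⁻¹ * t).norm ≤ ν.norm := by
  by_cases h : s = t
  · simp [h]
  · exact hL.norm_le_of_mem_sigma (hC hs ht h).2

theorem IsLexicographic.norm_le_of_mem_clique (hL : IsLexicographic L)
    (hC : (gamma ν).IsClique C) (h1 : 1 ∈ C) {c : FreeGroup (Fin m)} (hc : c ∈ C) :
    c.norm ≤ ν.norm := by
  simpa using hL.norm_inv_mul_le_of_isClique hC h1 hc

/-- Cliques through `1` lie in the finite ball of radius `|ν|`. Uniqueness needs this existence,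
because `param_eq_zero` only speaks about a given maximal clique. -/
theorem IsLexicographic.exists_maximal_clique (hL : IsLexicographic L) (hν : ν ≠ 1) :
    ∃ C : Finset (FreeGroup (Fin m)),
      Maximal (gamma ν).IsClique (C : Set (FreeGroup (Fin m))) ∧ 1 ∈ C ∧ ν ∈ C := by
  have hfin : {C : Set (FreeGroup (Fin m)) | (gamma ν).IsClique C ∧ 1 ∈ C}.Finite := by
    refine (finite_ball ν.norm).finite_subsets.subset ?_
    intro C hC c hc
    exact hL.norm_le_of_mem_clique hC.1 hC.2 hc
  have h0 : ({1, ν} : Set (FreeGroup (Fin m))) ∈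
      {C : Set (FreeGroup (Fin m)) | (gamma ν).IsClique C ∧ 1 ∈ C} := by
    refine ⟨?_, by simp⟩
    rw [SimpleGraph.isClique_pair]
    exact fun _ => gamma_adj_one hν
  obtain ⟨C, hC, hmax⟩ := hfin.exists_le_maximal h0
  have hCfin : C.Finite := (finite_ball ν.norm).subset fun c hc =>
    hL.norm_le_of_mem_clique hmax.prop.1 hmax.prop.2 hc
  refine ⟨hCfin.toFinset, ?_, by simpa using hmax.prop.2, by simpa using hC (by simp)⟩
  rw [Set.Finite.coe_toFinset]
  exact ⟨hmax.prop.1, fun D hD hCD => hmax.le_of_ge ⟨hD, hCD hmax.prop.2⟩ hCD⟩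

/-- All the elements `c ≠ 1` of a clique of `Γ_ν` which contains `1` and `ν` begin with the same
letter as `ν`. -/
theorem IsLexicographic.exists_toWord_eq_cons (hL : IsLexicographic L)
    (hC : (gamma ν).IsClique C) (hν : ν ∈ C) {a : Fin m × Bool}
    {v : List (Fin m × Bool)} (ha : ν.toWord = a :: v) {c : FreeGroup (Fin m)} (hc : c ∈ C)
    (hc1 : c ≠ 1) : ∃ w, c.toWord = a :: w := by
  rcases hw : c.toWord with _ | ⟨b, w⟩
  · exact absurd (toWord_eq_nil_iff.1 hw) hc1
  · by_cases hab : b = a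
    · exact ⟨w, by rw [hab]⟩
    -- Different first letters leave no cancellation: `|c⁻¹ν| = |c| + |ν| > |ν|`.
    · have h := hL.norm_inv_mul_le_of_isClique hC hc hν
      rw [norm_inv_mul_of_toWord (u := []) (by simpa using hw) (by simpa using ha)
        (by simpa using hab), FreeGroup.norm, ha] at h
      simp at h

/-- The letter is at distance `1 < |ν|` from `1` and `|c| - 1 < |ν|` from every other `c`, so
maximality forces it into the clique. -/
theorem IsLexicographic.first_letter_mem (hL : IsLexicographic L)
    (hC : Maximal (gamma ν).IsClique C) (h1 : 1 ∈ C) (hν : ν ∈ C) {a : Fin m × Bool}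
    {v : List (Fin m × Bool)} (ha : ν.toWord = a :: v) (hn : 1 < ν.norm) :
    FreeGroup.mk [a] ∈ C := by
  refine hC.mem_of_prop_insert ?_
  refine SimpleGraph.isClique_insert.2 ⟨hC.prop, fun c hc hne => ⟨hne, ?_⟩⟩
  refine hL.mem_sigma_of_norm_lt ?_
  by_cases hc1 : c = 1
  · subst hc1
    rw [mul_one, norm_inv_eq, norm_mk_singleton]
    exact hn
  · obtain ⟨w, hw⟩ := hL.exists_toWord_eq_cons hC.prop hν ha hc hc1
    have h2 := norm_mk_singleton_inv_mul hw
    have h3 := hL.norm_le_of_mem_clique hC.prop h1 hc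
    omega

theorem IsLexicographic.inv_notMem_clique (hL : IsLexicographic L)
    (hC : (gamma ν).IsClique C) (hν : ν ∈ C) (hν1 : ν ≠ 1) : ν⁻¹ ∉ C := by
  intro h
  have h2 := hL.norm_inv_mul_le_of_isClique hC h hν
  rw [inv_inv] at h2
  exact absurd (norm_lt_norm_mul_self hν1) (not_lt.2 h2)

end Cliques

end FreeExt

noncomputable section

namespace FreeExt

/-! ### Realizations of positive block matrices -/

section Realization

open scoped ComplexOrder InnerProductSpace

variable {ι H : Type*} [Fintype ι] [NormedAddCommGroup H] [InnerProductSpace ℂ H]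

theorem inner_blockOp (A : ι → ι → H →L[ℂ] H) (x y : PiLp 2 (fun _ : ι => H)) :
    ⟪x, blockOp A y⟫_ℂ = ∑ i, ∑ j, ⟪x i, A i j (y j)⟫_ℂ := by
  simp [blockOp, PiLp.inner_apply, inner_sum]

theorem isPositive_blockOp_iff (A : ι → ι → H →L[ℂ] H) :
    (blockOp A).IsPositive ↔ ∀ x : ι → H, 0 ≤ ∑ i, ∑ j, ⟪x i, A i j (x j)⟫_ℂ := by
  constructor
  · intro h x
    have := h.inner_nonneg_right (WithLp.toLp 2 x)
    rwa [inner_blockOp] at this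
  · intro h
    have h' : ∀ x, 0 ≤ ⟪x, blockOp A x⟫_ℂ := fun x => by
      rw [inner_blockOp]
      exact h x
    refine (LinearMap.isPositive_iff_complex _).2 fun x => ?_
    have hx := Complex.nonneg_iff.1 (h' x)
    have e : ⟪blockOp A x, x⟫_ℂ = ⟪x, blockOp A x⟫_ℂ := by
      rw [← inner_conj_symm]
      exact Complex.conj_eq_iff_im.2 hx.2.symm
    change ((⟪blockOp A x, x⟫_ℂ).re : ℂ) = ⟪blockOp A x, x⟫_ℂ ∧ 0 ≤ (⟪blockOp A x, x⟫_ℂ).re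
    rw [e]
    exact ⟨Complex.ext rfl (by simpa using hx.2), hx.1⟩

theorem isPositive_blockOp_of_equiv {κ : Type*} [Fintype κ] (e : ι ≃ κ)
    {A : κ → κ → H →L[ℂ] H} (h : (blockOp fun i j => A (e i) (e j)).IsPositive) :
    (blockOp A).IsPositive := by
  rw [isPositive_blockOp_iff] at h ⊢
  intro x
  have := h (fun i => x (e i))
  rw [← e.sum_comp]
  simp_rw [← e.sum_comp (fun j => ⟪x (e _), A (e _) j (x j)⟫_ℂ)]
  exact this

variable [CompleteSpace H] {A : ι → ι → H →L[ℂ] H}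

theorem inner_omega (hA : (blockOp A).IsPositive) (i j : ι) (x y : H) :
    ⟪omega A i x, omega A j y⟫_ℂ = ⟪x, A i j y⟫_ℂ := by
  have h0 : 0 ≤ blockOp A := (ContinuousLinearMap.nonneg_iff_isPositive _).2 hA
  have hS : (CFC.sqrt (blockOp A)).IsPositive :=
    (ContinuousLinearMap.nonneg_iff_isPositive _).1 (CFC.sqrt_nonneg _)
  have h2 : CFC.sqrt (blockOp A) (CFC.sqrt (blockOp A) (coordEmb H j y)) =
      blockOp A (coordEmb H j y) :=
    congrArg (fun T : PiLp 2 (fun _ : ι => H) →L[ℂ] PiLp 2 (fun _ : ι => H) =>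
      T (coordEmb H j y)) (CFC.sqrt_mul_sqrt_self (blockOp A) h0)
  classical
  have hc : ∀ (i k : ι) (x : H), coordEmb H i x k = if k = i then x else 0 := by
    intro i k x
    simp [coordEmb]
  change ⟪CFC.sqrt (blockOp A) (coordEmb H i x), CFC.sqrt (blockOp A) (coordEmb H j y)⟫_ℂ = _
  rw [hS.inner_left_eq_inner_right, h2, inner_blockOp, Finset.sum_eq_single i,
    Finset.sum_eq_single j]
  · simp [hc]
  · intro b _ hb
    simp [hc, hb]
  · simp
  · intro b _ hb
    simp [hc, hb]
  · simp

theorem omega_mem_realization {J : Set ι} {i : ι} (hi : i ∈ J) (x : H) :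
    omega A i x ∈ realization A J :=
  Submodule.le_topologicalClosure _
    (Submodule.mem_iSup_of_mem i (Submodule.mem_iSup_of_mem hi ⟨x, rfl⟩))

theorem realization_le {J : Set ι} {K : Submodule ℂ (PiLp 2 (fun _ : ι => H))}
    (hK : IsClosed (K : Set (PiLp 2 (fun _ : ι => H)))) (h : ∀ i ∈ J, ∀ x, omega A i x ∈ K) :
    realization A J ≤ K := by
  refine Submodule.topologicalClosure_minimal _ (iSup₂_le fun i hi => ?_) hK
  rintro _ ⟨x, rfl⟩
  exact h i hi x

theorem realization_mono {J J' : Set ι} (h : J ⊆ J') : realization A J ≤ realization A J' :=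
  realization_le (Submodule.isClosed_topologicalClosure _) fun _ hi x =>
    omega_mem_realization (h hi) x

instance completeSpace_realization (J : Set ι) : CompleteSpace (realization A J) :=
  (Submodule.isClosed_topologicalClosure _).completeSpace_coe

theorem mem_realization_orthogonal {J : Set ι} {y : PiLp 2 (fun _ : ι => H)}
    (h : ∀ i ∈ J, ∀ x, ⟪y, omega A i x⟫_ℂ = 0) : y ∈ (realization A J)ᗮ := by
  rw [Submodule.mem_orthogonal']
  have : realization A J ≤ (ℂ ∙ y)ᗮ :=
    realization_le (Submodule.isClosed_orthogonal _) fun i hi x =>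
      Submodule.mem_orthogonal_singleton_iff_inner_right.2 (h i hi x)
  exact fun u hu => Submodule.mem_orthogonal_singleton_iff_inner_right.1 (this hu)

theorem completionParam_eq_zero_iff_inner (k l : ι) :
    completionParam A k l = 0 ↔ ∀ x ∈ realizationDiff A {k}ᶜ {k, l}ᶜ,
      ∀ y ∈ realizationDiff A {l}ᶜ {k, l}ᶜ, ⟪y, x⟫_ℂ = 0 := by
  simp_rw [← Submodule.mem_orthogonal]
  rw [ContinuousLinearMap.ext_iff, Subtype.forall]
  refine forall₂_congr fun x hx => ?_
  rw [completionParam, ContinuousLinearMap.comp_apply, zero_apply, Submodule.subtypeL_apply]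
  exact Submodule.orthogonalProjectionOnto_eq_zero_iff

/-- If the index `p` separates `l` from all the indices other than `k` and `l`, the parameter
vanishes iff `p` separates `l` from `k` as well. -/
theorem completionParam_eq_zero_iff (hA : (blockOp A).IsPositive) {k l p : ι} (hkl : k ≠ l)
    (hpk : p ≠ k) (hpl : p ≠ l) (T : H →L[ℂ] H)
    (hT : ∀ i, i ≠ k → i ≠ l → A i l = A i p ∘L T) :
    completionParam A k l = 0 ↔ A k l = A k p ∘L T := by
  -- Pairing `ω_l h - ω_p T h` with `ω_i` measures the failure of `A i l = A i p ∘L T`.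
  have hD : ∀ (i : ι) (x h : H), ⟪omega A i x, omega A l h - omega A p (T h)⟫_ℂ =
      ⟪x, (A i l - A i p ∘L T) h⟫_ℂ := by
    intro i x h
    rw [inner_sub_right, inner_omega hA, inner_omega hA, ← inner_sub_right]
    rfl
  have hpkl : p ∈ ({k, l}ᶜ : Set ι) := by simp [hpk, hpl]
  have hD' : ∀ h : H, omega A l h - omega A p (T h) ∈ (realization A {k, l}ᶜ)ᗮ := by
    intro h
    refine mem_realization_orthogonal fun i hi x => ?_
    simp only [Set.mem_compl_iff, Set.mem_insert_iff, Set.mem_singleton_iff, not_or] at hi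
    rw [← inner_conj_symm, hD, hT i hi.1 hi.2]
    simp
  rw [completionParam_eq_zero_iff_inner]
  constructor
  · intro H0
    ext h
    rw [← sub_eq_zero, ← sub_apply, ← inner_self_eq_zero (𝕜 := ℂ), ← hD]
    -- The defect is paired with itself: `⟪u, u⟫` is the pairing of `ω_k u` with `ω_l h - ω_p T h`,
    -- and the projection of `ω_k u` subtracted below does not contribute to it.
    set u := (A k l - A k p ∘L T) h with hu
    have hdec := H0 (omega A l h - omega A p (T h)) ⟨Submodule.sub_mem _
      (omega_mem_realization (by simpa using hkl.symm) _)
      (omega_mem_realization (by simpa using hpk) _), hD' h⟩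
      (omega A k u - (realization A {k, l}ᶜ).starProjection (omega A k u)) ⟨Submodule.sub_mem _
        (omega_mem_realization (by simpa using hkl) _)
        (realization_mono (by simp) (Submodule.starProjection_apply_mem _ _)),
        Submodule.sub_starProjection_mem_orthogonal _⟩
    rw [inner_sub_left, sub_eq_zero] at hdec
    rw [hdec]
    exact Submodule.inner_right_of_mem_orthogonal (Submodule.starProjection_apply_mem _ _) (hD' h)
  · intro hk x hx y hy
    have hDl : ∀ h : H, omega A l h - omega A p (T h) ∈ (realization A {l}ᶜ)ᗮ := by
      intro h
      refine mem_realization_orthogonal fun i hi x => ?_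
      have hil : A i l = A i p ∘L T := by
        by_cases hik : i = k
        · rw [hik, hk]
        · exact hT i hik hi
      rw [← inner_conj_symm, hD, hil]
      simp
    -- It is enough that `y` is orthogonal to `ω_i` for all `i ≠ k`; only `i = l` is new, and there
    -- `ω_l` splits into a part orthogonal to the space containing `y` and a part in the range of
    -- `ω_p`.
    refine Submodule.inner_left_of_mem_orthogonal hx.1 (mem_realization_orthogonal ?_)
    intro i hi z
    by_cases hil : i = l
    · subst hil
      have e : omega A i z = (omega A i z - omega A p (T z)) + omega A p (T z) := by abel
      rw [e, inner_add_right, Submodule.inner_right_of_mem_orthogonal hy.1 (hDl z),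
        Submodule.inner_left_of_mem_orthogonal (omega_mem_realization hpkl _) hy.2, add_zero]
    · refine Submodule.inner_left_of_mem_orthogonal (omega_mem_realization ?_ z) hy.2
      have hik : i ≠ k := hi
      simp [hil, hik]

theorem adjoint_eq_of_isPositive_blockOp (hA : (blockOp A).IsPositive) (i j : ι) :
    ContinuousLinearMap.adjoint (A i j) = A j i := by
  symm
  rw [ContinuousLinearMap.eq_adjoint_iff]
  intro x y
  rw [← inner_omega hA, ← inner_conj_symm, ← inner_omega hA j i, inner_conj_symm]

end Realization

end FreeExt

end

noncomputable section

namespace FreeExt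

/-! ### Quasi-multiplicative functions are positive definite -/

section Kernel

open scoped ComplexOrder InnerProductSpace

variable {G H : Type*} [Group G] [NormedAddCommGroup H] [InnerProductSpace ℂ H]

/-- The sesquilinear form on finitely supported functions defined by an operator valued function
on a group. -/
def kernelForm (Φ : G → H →L[ℂ] H) (f g : G →₀ H) : ℂ :=
  f.sum fun s x => g.sum fun t y => ⟪x, Φ (s⁻¹ * t) y⟫_ℂ

variable (Φ : G → H →L[ℂ] H)

theorem kernelForm_add_right (f g g' : G →₀ H) :
    kernelForm Φ f (g + g') = kernelForm Φ f g + kernelForm Φ f g' := by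
  classical
  rw [kernelForm, kernelForm, kernelForm, ← Finsupp.sum_add]
  refine Finsupp.sum_congr fun s _ => ?_
  exact Finsupp.sum_add_index' (by simp) (by simp)

theorem kernelForm_add_left (f f' g : G →₀ H) :
    kernelForm Φ (f + f') g = kernelForm Φ f g + kernelForm Φ f' g := by
  classical
  exact Finsupp.sum_add_index' (by simp) (by simp [Finsupp.sum_add])

theorem kernelForm_single_single (s t : G) (x y : H) :
    kernelForm Φ (Finsupp.single s x) (Finsupp.single t y) = ⟪x, Φ (s⁻¹ * t) y⟫_ℂ := by
  rw [kernelForm, Finsupp.sum_single_index, Finsupp.sum_single_index] <;> simp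

theorem kernelForm_single_right (f : G →₀ H) (t : G) (y : H) :
    kernelForm Φ f (Finsupp.single t y) = f.sum fun s x => ⟪x, Φ (s⁻¹ * t) y⟫_ℂ := by
  rw [kernelForm]
  refine Finsupp.sum_congr fun s _ => ?_
  rw [Finsupp.sum_single_index]
  simp

/-- Links tuples of group elements, possibly with repetitions, to finitely supported functions,
where vectors at the same element are added. -/
theorem kernelForm_sum_sum {ι : Type*} [Fintype ι] (s : ι → G) (x : ι → H) :
    kernelForm Φ (∑ i, Finsupp.single (s i) (x i)) (∑ i, Finsupp.single (s i) (x i)) =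
      ∑ i, ∑ j, ⟪x i, Φ ((s i)⁻¹ * s j) (x j)⟫_ℂ := by
  have hl : ∀ (g : G →₀ H) (t : Finset ι),
      kernelForm Φ (∑ i ∈ t, Finsupp.single (s i) (x i)) g =
        ∑ i ∈ t, kernelForm Φ (Finsupp.single (s i) (x i)) g := fun g t =>
    map_sum (AddMonoidHom.mk' (fun f => kernelForm Φ f g)
      (fun f f' => kernelForm_add_left Φ f f' g)) _ t
  have hr : ∀ (f : G →₀ H) (t : Finset ι),
      kernelForm Φ f (∑ i ∈ t, Finsupp.single (s i) (x i)) =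
        ∑ i ∈ t, kernelForm Φ f (Finsupp.single (s i) (x i)) := fun f t =>
    map_sum (AddMonoidHom.mk' (fun g => kernelForm Φ f g)
      (fun g g' => kernelForm_add_right Φ f g g')) _ t
  simp_rw [hl, hr, kernelForm_single_single]

variable {Φ} [CompleteSpace H]

theorem conj_kernelForm (hΦ : ∀ s, Φ s⁻¹ = ContinuousLinearMap.adjoint (Φ s)) (f g : G →₀ H) :
    (starRingEnd ℂ) (kernelForm Φ f g) = kernelForm Φ g f := by
  rw [kernelForm, kernelForm, Finsupp.sum_comm, Finsupp.sum, Finsupp.sum, map_sum]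
  refine Finset.sum_congr rfl fun t _ => ?_
  rw [Finsupp.sum, Finsupp.sum, map_sum]
  refine Finset.sum_congr rfl fun s _ => ?_
  rw [inner_conj_symm, ← ContinuousLinearMap.adjoint_inner_right, ← hΦ, mul_inv_rev, inv_inv]

end Kernel

/-! ### Positivity by shortening the longest word. -/

section QuasiMultiplicative

open scoped ComplexOrder InnerProductSpace

variable {m : ℕ} {H : Type*} [NormedAddCommGroup H] [InnerProductSpace ℂ H] [CompleteSpace H]
  {Φ : FreeGroup (Fin m) → H →L[ℂ] H}

/-- Moving the vector at a longest word to the word without the last letter does not increase the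
quadratic form of a quasi-multiplicative function. -/
theorem IsQuasiMultiplicative.kernelForm_move_le (hΦ : IsQuasiMultiplicative Φ)
    {c p : FreeGroup (Fin m)} {a : Fin m × Bool} (hc : c.toWord = p.toWord ++ [a])
    (g : FreeGroup (Fin m) →₀ H) (hg : ∀ s ∈ g.support, s.norm ≤ c.norm ∧ s ≠ c) (x : H) :
    (kernelForm Φ (Finsupp.single p (Φ (p⁻¹ * c) x) + g)
      (Finsupp.single p (Φ (p⁻¹ * c) x) + g)).re ≤
    (kernelForm Φ (Finsupp.single c x + g) (Finsupp.single c x + g)).re := by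
  have hpc : (p⁻¹ * c).norm = 1 := by
    rw [norm_inv_mul_of_toWord (u := p.toWord) (w := []) (z := [a]) (by simp) hc (by simp)]
    simp
  have hgc : kernelForm Φ g (Finsupp.single c x) =
      kernelForm Φ g (Finsupp.single p (Φ (p⁻¹ * c) x)) := by
    rw [kernelForm_single_right, kernelForm_single_right]
    refine Finsupp.sum_congr fun s hs => ?_
    have h := hΦ.map_mul (s⁻¹ * p) (p⁻¹ * c) (by
      rw [hpc, mul_assoc, mul_inv_cancel_left,
        norm_inv_mul_eq_add_one hc (hg s hs).1 (hg s hs).2])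
    rw [mul_assoc, mul_inv_cancel_left] at h
    rw [h]
    rfl
  have hnorm : ‖Φ (p⁻¹ * c) x‖ ≤ ‖x‖ := by
    simpa using (Φ (p⁻¹ * c)).le_of_opNorm_le (hΦ.norm_le_one _) x
  have hdiag : ∀ (s : FreeGroup (Fin m)) (y : H),
      (kernelForm Φ (Finsupp.single s y) (Finsupp.single s y)).re = ‖y‖ ^ 2 := by
    intro s y
    rw [kernelForm_single_single, inv_mul_cancel, hΦ.map_one, ContinuousLinearMap.id_apply,
      ← RCLike.re_eq_complex_re, inner_self_eq_norm_sq]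
  simp only [kernelForm_add_left, kernelForm_add_right, Complex.add_re, hdiag]
  -- The remaining cross terms are conjugates of those in `hgc`, so the two forms differ only in
  -- their diagonal terms.
  rw [← conj_kernelForm hΦ.map_inv g (Finsupp.single c x),
    ← conj_kernelForm hΦ.map_inv g (Finsupp.single p _), hgc]
  have := pow_le_pow_left₀ (norm_nonneg _) hnorm 2
  linarith

theorem IsQuasiMultiplicative.re_kernelForm_nonneg (hΦ : IsQuasiMultiplicative Φ)
    (f : FreeGroup (Fin m) →₀ H) : 0 ≤ (kernelForm Φ f f).re := by
  classical
  -- Induction on the total length of the support, which drops when `c` is replaced by the shorter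
  -- `p`.
  induction hn : ∑ s ∈ f.support, s.norm using Nat.strong_induction_on generalizing f with
  | _ n ih =>
    rcases f.support.eq_empty_or_nonempty with h0 | hne
    · rw [Finsupp.support_eq_empty.1 h0]
      simp [kernelForm]
    obtain ⟨c, hcf, hmax⟩ := f.support.exists_max_image FreeGroup.norm hne
    by_cases hc1 : c = 1
    · have hf : f = Finsupp.single 1 (f 1) := by
        rw [Finsupp.eq_single_iff]
        refine ⟨fun s hs => ?_, rfl⟩
        have := hmax s hs
        rw [hc1, FreeGroup.norm_one, Nat.le_zero, FreeGroup.norm_eq_zero] at this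
        simpa using this
      rw [hf, kernelForm_single_single, inv_mul_cancel, hΦ.map_one,
        ContinuousLinearMap.id_apply, ← RCLike.re_eq_complex_re]
      exact inner_self_nonneg
    · obtain ⟨p, a, hpa⟩ := exists_toWord_eq_append hc1
      have hmove := hΦ.kernelForm_move_le hpa (f.erase c) (fun s hs => by
        rw [Finsupp.support_erase, Finset.mem_erase] at hs
        exact ⟨hmax s hs.2, hs.1⟩) (f c)
      rw [Finsupp.single_add_erase] at hmove
      refine (ih _ ?_ _ rfl).trans hmove
      have hlt : p.norm < c.norm := by
        rw [FreeGroup.norm, FreeGroup.norm, hpa]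
        simp
      have hsub : (Finsupp.single p (Φ (p⁻¹ * c) (f c)) + f.erase c).support ⊆
          insert p (f.support.erase c) := by
        refine Finsupp.support_add.trans (Finset.union_subset ?_ ?_)
        · exact Finsupp.support_single_subset.trans (by simp)
        · rw [Finsupp.support_erase]
          exact Finset.subset_insert _ _
      have h1 := Finset.sum_le_sum_of_subset (f := FreeGroup.norm) hsub
      -- Only an inequality: `p` may already carry a vector.
      have h2 : ∑ s ∈ insert p (f.support.erase c), s.norm ≤
          p.norm + ∑ s ∈ f.support.erase c, s.norm := by
        by_cases hp : p ∈ f.support.erase c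
        · rw [Finset.insert_eq_of_mem hp]
          exact Nat.le_add_left _ _
        · rw [Finset.sum_insert hp]
      have h3 := Finset.add_sum_erase f.support FreeGroup.norm hcf
      omega

/-- Quasi-multiplicative functions on a free group are positive definite. -/
theorem IsQuasiMultiplicative.isPosDef (hΦ : IsQuasiMultiplicative Φ) : IsPosDef Φ := by
  intro k s
  rw [isPositive_blockOp_iff]
  intro x
  rw [← kernelForm_sum_sum]
  refine Complex.nonneg_iff.2 ⟨hΦ.re_kernelForm_nonneg _, ?_⟩
  exact (Complex.conj_eq_iff_im.1 (conj_kernelForm hΦ.map_inv _ _)).symm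

end QuasiMultiplicative

/-! ### Central extensions -/

section Central

open FreeGroup

variable {m : ℕ} {H : Type*} [NormedAddCommGroup H] [InnerProductSpace ℂ H]

theorem IsPosDef.isPositive_blockOp {Ψ : FreeGroup (Fin m) → H →L[ℂ] H} (hΨ : IsPosDef Ψ)
    (C : Finset (FreeGroup (Fin m))) :
    (blockOp fun s t : C => Ψ ((s : FreeGroup (Fin m))⁻¹ * t)).IsPositive :=
  isPositive_blockOp_of_equiv (Fintype.equivFin C).symm
    (hΨ _ fun i => ((Fintype.equivFin C).symm i : FreeGroup (Fin m)))

variable [CompleteSpace H] {Φ Ψ : FreeGroup (Fin m) → H →L[ℂ] H}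

theorem IsPosDef.map_inv (hΨ : IsPosDef Ψ) (s : FreeGroup (Fin m)) :
    Ψ s⁻¹ = ContinuousLinearMap.adjoint (Ψ s) := by
  have := adjoint_eq_of_isPositive_blockOp (hΨ 2 ![1, s]) 0 1
  simpa using this.symm

/-- The reduced form of `c⁻¹` ends in `a⁻¹`, so splitting off this letter is length additive. -/
theorem IsQuasiMultiplicative.map_inv_of_toWord (hΦ : IsQuasiMultiplicative Φ)
    {a : Fin m × Bool} {v : List (Fin m × Bool)} {c : FreeGroup (Fin m)}
    (hc : c.toWord = a :: v) : Φ c⁻¹ = Φ (c⁻¹ * FreeGroup.mk [a]) ∘L Φ (FreeGroup.mk [a])⁻¹ := by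
  rw [← hΦ.map_mul, mul_inv_cancel_right]
  have h := norm_mk_singleton_inv_mul hc
  rw [mul_inv_cancel_right, norm_inv_eq, norm_inv_eq, ← norm_inv_eq (x := c⁻¹ * _), mul_inv_rev,
    inv_inv, ← h, norm_mk_singleton]

/-- For a positive definite function which agrees with a quasi-multiplicative function below `ν`,
the parameter at `ν` vanishes iff the agreement extends to `ν⁻¹`. -/
theorem IsQuasiMultiplicative.completionParam_eq_zero_iff (hΦ : IsQuasiMultiplicative Φ)
    (hΨ : IsPosDef Ψ) {L : LinearOrder (FreeGroup (Fin m))} (hL : IsLexicographic L)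
    {ν : FreeGroup (Fin m)} (hn : 1 < ν.norm)
    (hΨΦ : ∀ s, min s s⁻¹ < min ν ν⁻¹ → Ψ s = Φ s)
    {C : Finset (FreeGroup (Fin m))} (hC : Maximal (gamma ν).IsClique (C : Set (FreeGroup (Fin m))))
    (h1 : 1 ∈ C) (hν : ν ∈ C) :
    completionParam (fun s t : C => Ψ ((s : FreeGroup (Fin m))⁻¹ * t)) ⟨ν, hν⟩ ⟨1, h1⟩ = 0 ↔
      Ψ ν⁻¹ = Φ ν⁻¹ := by
  have hν1 : ν ≠ 1 := by
    rintro rfl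
    simp at hn
  have hlt : ∀ s : FreeGroup (Fin m), s.norm < ν.norm → Ψ s = Φ s := fun s hs =>
    hΨΦ s (lt_of_not_ge fun h => absurd (hL.norm_le h)
      (by rw [norm_min_inv, norm_min_inv]; exact not_le.2 hs))
  obtain ⟨a, v, ha⟩ : ∃ a v, ν.toWord = a :: v :=
    List.exists_cons_of_ne_nil (by simpa using hν1)
  have hpC := hL.first_letter_mem hC h1 hν ha hn
  have hpn := norm_mk_singleton a
  have hp : Ψ (FreeGroup.mk [a])⁻¹ = Φ (FreeGroup.mk [a])⁻¹ :=
    hlt _ (by rw [norm_inv_eq, hpn]; exact hn)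
  have hcp : ∀ c ∈ C, c ≠ 1 →
      Φ c⁻¹ = Ψ (c⁻¹ * FreeGroup.mk [a]) ∘L Ψ (FreeGroup.mk [a])⁻¹ := by
    intro c hc hc1
    obtain ⟨w, hw⟩ := hL.exists_toWord_eq_cons hC.prop hν ha hc hc1
    rw [hp, hlt, ← hΦ.map_inv_of_toWord hw]
    have h2 := norm_mk_singleton_inv_mul hw
    have h3 := hL.norm_le_of_mem_clique hC.prop h1 hc
    rw [← norm_inv_eq, mul_inv_rev, inv_inv]
    omega
  rw [FreeExt.completionParam_eq_zero_iff (hΨ.isPositive_blockOp C) (p := ⟨FreeGroup.mk [a], hpC⟩)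
    (T := Ψ (FreeGroup.mk [a])⁻¹) (by simpa using hν1) ?_ ?_ ?_]
  · rw [← hcp ν hν hν1, mul_one]
  · intro h
    rw [Subtype.mk.injEq] at h
    rw [← h, hpn] at hn
    exact lt_irrefl _ hn
  · intro h
    rw [Subtype.mk.injEq] at h
    rw [h] at hpn
    simp at hpn
  · rintro ⟨c, hc⟩ hcν hc1
    rw [Ne, Subtype.mk.injEq] at hcν hc1
    rw [← hcp c hc hc1, mul_one]
    -- Adjacency of `c` to `1` gives `≤`. Equality of classes would mean `c = ν` or `c = ν⁻¹`; the
    -- latter is excluded because `|ν²| > |ν|`.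
    refine hΨΦ _ (lt_of_le_of_ne ?_ ?_)
    · have := (hC.prop (Finset.mem_coe.2 h1) (Finset.mem_coe.2 hc) (Ne.symm hc1)).2
      rw [inv_one, one_mul] at this
      rw [inv_inv, min_comm]
      exact this
    · intro h
      have hνC := hL.inv_notMem_clique hC.prop (Finset.mem_coe.2 hν) hν1
      rw [inv_inv] at h
      rcases min_choice c⁻¹ c with h2 | h2 <;> rcases min_choice ν ν⁻¹ with h3 | h3 <;>
        rw [h2, h3] at h
      · exact hνC (by rw [← h, inv_inv]; exact hc)
      · exact hcν (inv_injective h)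
      · exact hcν h
      · exact hνC (by rw [← h]; exact hc)

/-- A quasi-multiplicative function is the only central extension of its restriction to `S_1`. -/
theorem IsCentralExtension.eq (hΦ : IsQuasiMultiplicative Φ)
    {L : LinearOrder (FreeGroup (Fin m))} (hL : IsLexicographic L)
    (hΨ : IsCentralExtension L (fun s : ball m 1 => Φ s) Ψ) : Ψ = Φ := by
  funext s
  -- Induction on the position of the class of `s`; each class has finitely many predecessors
  -- because the order refines length.
  induction hk : (Set.Iio (min s s⁻¹)).ncard using Nat.strong_induction_on generalizing s with
  | _ k ih =>
    by_cases hs : s.norm ≤ 1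
    · exact hΨ.extends_φ ⟨s, hs⟩
    have key : ∀ ν : FreeGroup (Fin m), min ν ν⁻¹ = min s s⁻¹ → ν ≤ ν⁻¹ → Ψ ν⁻¹ = Φ ν⁻¹ := by
      intro ν hνs hν
      have hn : 1 < ν.norm := by
        rw [← norm_min_inv, hνs, norm_min_inv]
        exact not_le.1 hs
      have hν1 : ν ≠ 1 := by
        rintro rfl
        simp at hn
      obtain ⟨C, hC, h1, hνC⟩ := hL.exists_maximal_clique hν1
      refine (hΦ.completionParam_eq_zero_iff hΨ.posDef hL hn (fun t ht => ?_) hC h1 hνC).1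
        (hΨ.param_eq_zero ν hn hν C hC h1 hνC)
      rw [hνs] at ht
      refine ih _ ?_ t rfl
      rw [← hk]
      exact Set.ncard_lt_ncard (Set.Iio_ssubset_Iio ht) (hL.finite_Iio _)
    -- The parameter is attached to the smaller of `s`, `s⁻¹` and determines the value at its
    -- inverse; taking adjoints gives the other value.
    rcases le_total s s⁻¹ with h | h
    · have := key s rfl h
      rw [hΨ.posDef.map_inv, hΦ.map_inv] at this
      exact ContinuousLinearMap.adjoint.injective this
    · have := key s⁻¹ (by rw [inv_inv, min_comm]) (by rwa [inv_inv])
      rwa [inv_inv] at this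

theorem IsQuasiMultiplicative.isCentralExtension (hΦ : IsQuasiMultiplicative Φ)
    {L : LinearOrder (FreeGroup (Fin m))} (hL : IsLexicographic L) :
    IsCentralExtension L (fun s : ball m 1 => Φ s) Φ where
  posDef := hΦ.isPosDef
  extends_φ _ := rfl
  param_eq_zero _ hn _ _ hC h1 hν :=
    (hΦ.completionParam_eq_zero_iff hΦ.isPosDef hL hn (fun _ _ => rfl) hC h1 hν).2 rfl

end Central

end FreeExt

end

theorem theorem6p2 {m : ℕ} {H : Type*} [NormedAddCommGroup H] [InnerProductSpace ℂ H]
    [CompleteSpace H] (Φ : FreeGroup (Fin m) → H →L[ℂ] H)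
    (hΦ : FreeExt.IsQuasiMultiplicative Φ)
    (L : LinearOrder (FreeGroup (Fin m))) (hL : FreeExt.IsLexicographic L)
    (Ψ : FreeGroup (Fin m) → H →L[ℂ] H) :
    FreeExt.IsCentralExtension L (fun s : FreeExt.ball m 1 => Φ s) Ψ ↔ Ψ = Φ := by
  refine ⟨FreeExt.IsCentralExtension.eq hΦ hL, ?_⟩
  rintro rfl
  exact hΦ.isCentralExtension hL
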